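/- Let $E$ be a (real) Banach lattice and $Y$ a (real) Banach space; operators are bounded and linear. Call vectors $x,y\in E$ disjoint if $|x|\wedge|y|=0$. An operator between Banach spaces is \emph{strictly singular} if there is no closed infinite-dimensional subspace of its domain on which it restricts to an isomorphism onto its image. An operator $T:E\to Y$ is \emph{disjointly non-singular}, $T\in\textrm{DN-S}(E,Y)$, if there is no sequence $(x_n)$ of pairwise disjoint non-zero vectors of $E$ such that the restriction of $T$ to the closed linear span $[x_n]$ is strictly singular. The Banach lattice $E$ is \emph{order continuous} if every net in $E$ decreasing in order to $0$ converges to $0$ in norm, and a \emph{weak unit} of $E$ is a vector $e\in E$, $e\ge 0$, such that $\||x|\wedge e\|=0$ implies $x=0$. For an ultrafilter $\mathcal U$ on a set $I$ and a Banach space $X$, the \emph{ultrapower} $X_{\mathcal U}$ is the quotient of $\ell_\infty(I,X)$ by the closed subspace $N_{\mathcal U}(X)=\{(x_i): \lim_{i\to\mathcal U}\|x_i\|=0\}$, with the quotient norm; $[(x_i)]$ denotes the class of $(x_i)$. If $X$ is a Banach lattice, then so is $X_{\mathcal U}$, with the order $[(x_i)]\le[(y_i)]$ if and only if there is $(z_i)\in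 N_{\mathcal U}(X)$ with $x_i+z_i\le y_i$ for all $i\in I$. The ultrapower of an operator $T:E\to Y$ is $T_{\mathcal U}:E_{\mathcal U}\to Y_{\mathcal U}$, $T_{\mathcal U}[(x_i)]=[(Tx_i)]$. \textbf{Corollary.} Suppose that $E$ is order continuous with a weak unit, and let $\mathcal U$ be a non-trivial (that is, non-principal) ultrafilter on a set $I$. If $T\in\textrm{DN-S}(E,Y)$, then $T_{\mathcal U}\in\textrm{DN-S}(E_{\mathcal U},Y_{\mathcal U})$. -/

import Mathlib

open scoped ENNReal

universe u v w

section Operators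

/-- An operator between Banach spaces is strictly singular if its restriction to a closed
infinite-dimensional subspace is never an isomorphism onto its image. -/
def StrictlySingular {X : Type u} {Y : Type v} [NormedAddCommGroup X] [NormedSpace ℝ X]
    [NormedAddCommGroup Y] [NormedSpace ℝ Y] (T : X →L[ℝ] Y) : Prop :=
  ¬ ∃ M : Submodule ℝ X, IsClosed (M : Set X) ∧ ¬ FiniteDimensional ℝ M ∧
    Topology.IsEmbedding (T.domRestrict M)

/-- The closed subspace `[xₙ]` generated by a sequence. -/
def closedSpanSeq {X : Type u} [NormedAddCommGroup X] [NormedSpace ℝ X] (x : ℕ → X) :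
    Submodule ℝ X :=
  (Submodule.span ℝ (Set.range x)).topologicalClosure

/-- A sequence of pairwise disjoint vectors: `|xₘ| ∧ |xₙ| = 0` for `m ≠ n`. -/
def IsDisjointSeq {E : Type u} [NormedAddCommGroup E] [Lattice E] (x : ℕ → E) : Prop :=
  Pairwise fun m n => |x m| ⊓ |x n| = 0

/-- An operator from a Banach lattice to a Banach space is disjointly non-singular if it is
strictly singular on no closed subspace generated by a disjoint sequence of non-zero vectors. -/
def DisjointlyNonSingular {E : Type u} {Y : Type v} [NormedAddCommGroup E] [NormedSpace ℝ E]
    [Lattice E] [NormedAddCommGroup Y] [NormedSpace ℝ Y] (T : E →L[ℝ] Y) : Prop :=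
  ¬ ∃ x : ℕ → E, (∀ n, x n ≠ 0) ∧ IsDisjointSeq x ∧
    StrictlySingular (T.domRestrict (closedSpanSeq x))

/-- A Banach lattice is order continuous if every net decreasing to `0` in order converges to `0`
in norm. (Index sets in the universe of `E` suffice: the range of a net is a subset of `E`.) -/
def OrderContinuousNorm (E : Type u) [NormedAddCommGroup E] [Lattice E] : Prop :=
  ∀ (ι : Type u) [Preorder ι] [IsDirectedOrder ι] [Nonempty ι] (x : ι → E),
    Antitone x → IsGLB (Set.range x) 0 → Filter.Tendsto x Filter.atTop (nhds 0)

/-- A weak unit: `e ≥ 0` such that `‖|x| ∧ e‖ = 0` implies `x = 0`. -/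
def IsWeakUnit {E : Type u} [NormedAddCommGroup E] [Lattice E] (e : E) : Prop :=
  0 ≤ e ∧ ∀ x : E, ‖|x| ⊓ e‖ = 0 → x = 0

end Operators

noncomputable section Ultrapowers

namespace Ultrapower

section Space

variable {I : Type w} (U : Ultrafilter I) (X : Type u) [NormedAddCommGroup X] [NormedSpace ℝ X]

/-- The subspace of bounded families `(xᵢ)` with `lim_U ‖xᵢ‖ = 0`. -/
def nullSubmodule : Submodule ℝ (lp (fun _ : I => X) ∞) where
  carrier := {x | Filter.Tendsto (fun i => ‖x i‖) U (nhds 0)}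
  zero_mem' := by simp
  add_mem' := by
    intro a b ha hb
    have h := Filter.Tendsto.add ha hb
    rw [add_zero] at h
    exact squeeze_zero (fun i => norm_nonneg _) (fun i => norm_add_le (a i) (b i)) h
  smul_mem' := by
    intro c x hx
    have h := Filter.Tendsto.const_mul ‖c‖ hx
    rw [mul_zero] at h
    refine h.congr fun i => ?_
    simp [norm_smul]

variable {U X}

theorem mem_nullSubmodule {x : lp (fun _ : I => X) ∞} :
    x ∈ nullSubmodule U X ↔ Filter.Tendsto (fun i => ‖x i‖) U (nhds 0) := Iff.rfl

theorem mem_nullSubmodule_iff {x : lp (fun _ : I => X) ∞} :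
    x ∈ nullSubmodule U X ↔ ∀ ε > 0, ∀ᶠ i in (U : Filter I), ‖x i‖ < ε := by
  rw [mem_nullSubmodule, Metric.tendsto_nhds]
  simp

variable (U X)

instance isClosed_nullSubmodule : IsClosed (nullSubmodule U X : Set (lp (fun _ : I => X) ∞)) := by
  rw [← closure_subset_iff_isClosed]
  intro x hx
  rw [SetLike.mem_coe, mem_nullSubmodule_iff]
  intro ε hε
  obtain ⟨y, hy, hxy⟩ := Metric.mem_closure_iff.1 hx (ε / 2) (half_pos hε)
  filter_upwards [mem_nullSubmodule_iff.1 hy (ε / 2) (half_pos hε)] with i hi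
  have h1 : ‖(x - y) i‖ ≤ ‖x - y‖ := lp.norm_apply_le_norm (by simp) _ i
  have h2 : ‖x i‖ ≤ ‖(x - y) i‖ + ‖y i‖ := by
    simpa using norm_add_le ((x - y) i) (y i)
  rw [dist_eq_norm] at hxy
  linarith

end Space

/-- The ultrapower `X_U`: the quotient of `ℓ_∞(I, X)` by the families whose norms tend to `0`
along `U`, with the quotient norm. -/
def _root_.Ultrapower {I : Type w} (U : Ultrafilter I) (X : Type u) [NormedAddCommGroup X]
    [NormedSpace ℝ X] : Type (max w u) :=
  lp (fun _ : I => X) ∞ ⧸ nullSubmodule U X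

section Norm

variable {I : Type w} (U : Ultrafilter I) {X : Type u} [NormedAddCommGroup X] [NormedSpace ℝ X]

instance instNormedAddCommGroup : NormedAddCommGroup (Ultrapower U X) :=
  inferInstanceAs (NormedAddCommGroup (lp (fun _ : I => X) ∞ ⧸ nullSubmodule U X))

instance instNormedSpace : NormedSpace ℝ (Ultrapower U X) :=
  inferInstanceAs (NormedSpace ℝ (lp (fun _ : I => X) ∞ ⧸ nullSubmodule U X))

instance instCompleteSpace [CompleteSpace X] : CompleteSpace (Ultrapower U X) :=
  inferInstanceAs (CompleteSpace (lp (fun _ : I => X) ∞ ⧸ nullSubmodule U X))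

/-- The quotient map, sending a bounded family to its class `[(xᵢ)]`. -/
def mk : lp (fun _ : I => X) ∞ →L[ℝ] Ultrapower U X :=
  (nullSubmodule U X).mkQL

theorem mk_surjective : Function.Surjective (mk U (X := X)) :=
  Submodule.Quotient.mk_surjective _

variable {U}

theorem mk_eq_mk {x y : lp (fun _ : I => X) ∞} :
    mk U x = mk U y ↔ x - y ∈ nullSubmodule U X :=
  Submodule.Quotient.eq _

theorem norm_mk_le (x : lp (fun _ : I => X) ∞) : ‖mk U x‖ ≤ ‖x‖ :=
  Submodule.Quotient.norm_mk_le _ x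

theorem exists_mk_eq_norm_lt (a : Ultrapower U X) {ε : ℝ} (hε : 0 < ε) :
    ∃ x : lp (fun _ : I => X) ∞, mk U x = a ∧ ‖x‖ < ‖a‖ + ε :=
  Submodule.Quotient.norm_mk_lt (S := nullSubmodule U X) a hε

end Norm

section Operator

variable {I : Type w} (U : Ultrafilter I) {X : Type u} {Y : Type v} [NormedAddCommGroup X]
  [NormedSpace ℝ X] [NormedAddCommGroup Y] [NormedSpace ℝ Y] (T : X →L[ℝ] Y)

/-- The coordinatewise action `(xᵢ) ↦ (T xᵢ)` on bounded families. -/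
def lpMap : lp (fun _ : I => X) ∞ →L[ℝ] lp (fun _ : I => Y) ∞ :=
  LinearMap.mkContinuous
    { toFun := fun x => ⟨fun i => T (x i), memℓp_infty ⟨‖T‖ * ‖x‖, by
        rintro _ ⟨i, rfl⟩
        exact T.le_of_opNorm_le_of_le le_rfl (lp.norm_apply_le_norm (by simp) x i)⟩⟩
      map_add' := fun x y => by ext i; exact T.map_add (x i) (y i)
      map_smul' := fun c x => by ext i; exact T.map_smul c (x i) } ‖T‖ (fun x =>
        lp.norm_le_of_forall_le (by positivity) fun i =>
          T.le_of_opNorm_le_of_le le_rfl (lp.norm_apply_le_norm (by simp) x i))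

@[simp] theorem lpMap_apply (x : lp (fun _ : I => X) ∞) (i : I) : lpMap T x i = T (x i) := rfl

theorem lpMap_mem {x : lp (fun _ : I => X) ∞} (hx : x ∈ nullSubmodule U X) :
    lpMap T x ∈ nullSubmodule U Y := by
  have h := Filter.Tendsto.const_mul ‖T‖ (mem_nullSubmodule.1 hx)
  rw [mul_zero] at h
  exact squeeze_zero (fun i => norm_nonneg _) (fun i => T.le_opNorm (x i)) h

/-- The ultrapower `T_U : X_U → Y_U`, `[(xᵢ)] ↦ [(T xᵢ)]`, of an operator. -/
def map : Ultrapower U X →L[ℝ] Ultrapower U Y :=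
  (nullSubmodule U X).liftQL ((mk U).comp (lpMap T)) (by
    intro x hx
    have h : mk U (lpMap T x) = mk U 0 := mk_eq_mk.2 (by simpa using lpMap_mem U T hx)
    simpa using h)

@[simp] theorem map_mk (x : lp (fun _ : I => X) ∞) : map U T (mk U x) = mk U (lpMap T x) := rfl

end Operator

section Order

set_option linter.unusedSectionVars false

variable {I : Type w} {U : Ultrafilter I} {E : Type u} [NormedAddCommGroup E] [NormedSpace ℝ E]
  [Lattice E] [HasSolidNorm E] [IsOrderedAddMonoid E]

/-- Coordinatewise supremum of bounded families. -/
def lpSup (x y : lp (fun _ : I => E) ∞) : lp (fun _ : I => E) ∞ :=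
  ⟨fun i => x i ⊔ y i, memℓp_infty ⟨‖x‖ + ‖y‖, by
    rintro _ ⟨i, rfl⟩
    exact (norm_sup_le_add _ _).trans (add_le_add (lp.norm_apply_le_norm (by simp) x i)
      (lp.norm_apply_le_norm (by simp) y i))⟩⟩

/-- Coordinatewise infimum of bounded families. -/
def lpInf (x y : lp (fun _ : I => E) ∞) : lp (fun _ : I => E) ∞ :=
  ⟨fun i => x i ⊓ y i, memℓp_infty ⟨‖x‖ + ‖y‖, by
    rintro _ ⟨i, rfl⟩
    exact (norm_inf_le_add _ _).trans (add_le_add (lp.norm_apply_le_norm (by simp) x i)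
      (lp.norm_apply_le_norm (by simp) y i))⟩⟩

@[simp] theorem lpSup_apply (x y : lp (fun _ : I => E) ∞) (i : I) :
    lpSup x y i = x i ⊔ y i := rfl

@[simp] theorem lpInf_apply (x y : lp (fun _ : I => E) ∞) (i : I) :
    lpInf x y i = x i ⊓ y i := rfl

theorem mem_of_norm_le_add {x a b : lp (fun _ : I => E) ∞} (ha : a ∈ nullSubmodule U E)
    (hb : b ∈ nullSubmodule U E) (h : ∀ i, ‖x i‖ ≤ ‖a i‖ + ‖b i‖) : x ∈ nullSubmodule U E := by
  have h' := Filter.Tendsto.add (mem_nullSubmodule.1 ha) (mem_nullSubmodule.1 hb)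
  rw [add_zero] at h'
  exact squeeze_zero (fun i => norm_nonneg _) h h'

/-- The order of the ultrapower: `[(xᵢ)] ≤ [(yᵢ)]` if there is `(zᵢ)` with `lim_U ‖zᵢ‖ = 0` and
`xᵢ + zᵢ ≤ yᵢ` for all `i`. -/
instance instLE : LE (Ultrapower U E) where
  le a b := ∃ x y : lp (fun _ : I => E) ∞, mk U x = a ∧ mk U y = b ∧
    ∃ z ∈ nullSubmodule U E, ∀ i, x i + z i ≤ y i

/-- The order does not depend on the representatives. -/
theorem mk_le_mk {x y : lp (fun _ : I => E) ∞} :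
    mk U x ≤ mk U y ↔ ∃ z ∈ nullSubmodule U E, ∀ i, x i + z i ≤ y i := by
  constructor
  · rintro ⟨x', y', hx, hy, z, hz, h⟩
    have hx' := mk_eq_mk.1 hx
    have hy' := mk_eq_mk.1 hy
    refine ⟨(x' - x) + z - (y' - y), sub_mem (add_mem hx' hz) hy', fun i => ?_⟩
    have h1 := sub_le_sub_right (h i) (y' i - y i)
    have h2 : y' i - (y' i - y i) = y i := by abel
    rw [h2] at h1
    refine le_trans (le_of_eq ?_) h1
    simp only [lp.coeFn_add, lp.coeFn_sub, Pi.add_apply, Pi.sub_apply]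
    abel
  · rintro ⟨z, hz, h⟩
    exact ⟨x, y, rfl, rfl, z, hz, h⟩

theorem mk_lpSup_congr {x x' y y' : lp (fun _ : I => E) ∞} (hx : x - x' ∈ nullSubmodule U E)
    (hy : y - y' ∈ nullSubmodule U E) : lpSup x y - lpSup x' y' ∈ nullSubmodule U E :=
  mem_of_norm_le_add hx hy fun i => norm_sup_sub_sup_le_add_norm (x i) (y i) (x' i) (y' i)

theorem mk_lpInf_congr {x x' y y' : lp (fun _ : I => E) ∞} (hx : x - x' ∈ nullSubmodule U E)
    (hy : y - y' ∈ nullSubmodule U E) : lpInf x y - lpInf x' y' ∈ nullSubmodule U E :=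
  mem_of_norm_le_add hx hy fun i => norm_inf_sub_inf_le_add_norm (x i) (y i) (x' i) (y' i)

/-- `[(xᵢ)] ∨ [(yᵢ)] = [(xᵢ ∨ yᵢ)]`. -/
instance instMax : Max (Ultrapower U E) where
  max := Quotient.map₂ lpSup fun _ _ hx _ _ hy =>
    (Submodule.quotientRel_def _).2 (mk_lpSup_congr ((Submodule.quotientRel_def _).1 hx)
      ((Submodule.quotientRel_def _).1 hy))

/-- `[(xᵢ)] ∧ [(yᵢ)] = [(xᵢ ∧ yᵢ)]`. -/
instance instMin : Min (Ultrapower U E) where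
  min := Quotient.map₂ lpInf fun _ _ hx _ _ hy =>
    (Submodule.quotientRel_def _).2 (mk_lpInf_congr ((Submodule.quotientRel_def _).1 hx)
      ((Submodule.quotientRel_def _).1 hy))

theorem mk_sup_mk (x y : lp (fun _ : I => E) ∞) : mk U x ⊔ mk U y = mk U (lpSup x y) := rfl

theorem mk_inf_mk (x y : lp (fun _ : I => E) ∞) : mk U x ⊓ mk U y = mk U (lpInf x y) := rfl

theorem mk_le_mk_of_le {x y : lp (fun _ : I => E) ∞} (h : ∀ i, x i ≤ y i) : mk U x ≤ mk U y :=
  mk_le_mk.2 ⟨0, zero_mem _, fun i => by simpa using h i⟩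

/-- Every inequality is witnessed by ordered representatives, the upper one prescribed. -/
theorem exists_le_rep {a : Ultrapower U E} {y : lp (fun _ : I => E) ∞} (h : a ≤ mk U y) :
    ∃ x : lp (fun _ : I => E) ∞, mk U x = a ∧ ∀ i, x i ≤ y i := by
  obtain ⟨x, rfl⟩ := mk_surjective U a
  obtain ⟨z, hz, h⟩ := mk_le_mk.1 h
  refine ⟨x + z, mk_eq_mk.2 ?_, h⟩
  simpa using hz

/-- Every inequality is witnessed by ordered representatives, the lower one prescribed. -/
theorem exists_ge_rep {b : Ultrapower U E} {x : lp (fun _ : I => E) ∞} (h : mk U x ≤ b) :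
    ∃ y : lp (fun _ : I => E) ∞, mk U y = b ∧ ∀ i, x i ≤ y i := by
  obtain ⟨y, rfl⟩ := mk_surjective U b
  obtain ⟨z, hz, h⟩ := mk_le_mk.1 h
  refine ⟨y - z, mk_eq_mk.2 ?_, fun i => le_sub_iff_add_le.2 (h i)⟩
  simpa using hz

instance instLattice : Lattice (Ultrapower U E) where
  le_refl a := by
    obtain ⟨x, rfl⟩ := mk_surjective U a
    exact mk_le_mk_of_le fun i => le_rfl
  le_trans a b c hab hbc := by
    obtain ⟨y, rfl⟩ := mk_surjective U b
    obtain ⟨x, rfl, hx⟩ := exists_le_rep hab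
    obtain ⟨z, rfl, hz⟩ := exists_ge_rep hbc
    exact mk_le_mk_of_le fun i => (hx i).trans (hz i)
  le_antisymm a b hab hba := by
    obtain ⟨x, rfl⟩ := mk_surjective U a
    obtain ⟨y, rfl⟩ := mk_surjective U b
    obtain ⟨z, hz, h⟩ := mk_le_mk.1 hab
    obtain ⟨t, ht, h'⟩ := mk_le_mk.1 hba
    refine mk_eq_mk.2 (mem_of_norm_le_add hz ht fun i => ?_)
    have h1 : x i - y i ≤ - z i := by
      rw [sub_le_iff_le_add, neg_add_eq_sub, le_sub_iff_add_le]; exact h i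
    have h2 : t i ≤ x i - y i := by rw [le_sub_iff_add_le, add_comm]; exact h' i
    have h3 : |x i - y i| ≤ |(|z i| + |t i|)| := by
      rw [abs_of_nonneg (add_nonneg (abs_nonneg (z i)) (abs_nonneg (t i)))]
      refine sup_le ?_ ?_
      · exact (h1.trans (neg_le_abs _)).trans (le_add_of_nonneg_right (abs_nonneg _))
      · exact ((neg_le_neg h2).trans (neg_le_abs _)).trans
          (le_add_of_nonneg_left (abs_nonneg _))
    have h4 := (HasSolidNorm.solid h3).trans (norm_add_le _ _)
    rwa [norm_abs_eq_norm, norm_abs_eq_norm] at h4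
  sup a b := a ⊔ b
  le_sup_left a b := by
    obtain ⟨x, rfl⟩ := mk_surjective U a
    obtain ⟨y, rfl⟩ := mk_surjective U b
    exact mk_le_mk_of_le fun i => le_sup_left
  le_sup_right a b := by
    obtain ⟨x, rfl⟩ := mk_surjective U a
    obtain ⟨y, rfl⟩ := mk_surjective U b
    exact mk_le_mk_of_le fun i => le_sup_right
  sup_le a b c hac hbc := by
    obtain ⟨z, rfl⟩ := mk_surjective U c
    obtain ⟨x, rfl, hx⟩ := exists_le_rep hac
    obtain ⟨y, rfl, hy⟩ := exists_le_rep hbc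
    exact mk_le_mk_of_le fun i => sup_le (hx i) (hy i)
  inf a b := a ⊓ b
  inf_le_left a b := by
    obtain ⟨x, rfl⟩ := mk_surjective U a
    obtain ⟨y, rfl⟩ := mk_surjective U b
    exact mk_le_mk_of_le fun i => inf_le_left
  inf_le_right a b := by
    obtain ⟨x, rfl⟩ := mk_surjective U a
    obtain ⟨y, rfl⟩ := mk_surjective U b
    exact mk_le_mk_of_le fun i => inf_le_right
  le_inf a b c hab hac := by
    obtain ⟨x, rfl⟩ := mk_surjective U a
    obtain ⟨y, rfl, hy⟩ := exists_ge_rep hab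
    obtain ⟨z, rfl, hz⟩ := exists_ge_rep hac
    exact mk_le_mk_of_le fun i => le_inf (hy i) (hz i)

instance instIsOrderedAddMonoid : IsOrderedAddMonoid (Ultrapower U E) where
  add_le_add_left a b h c := by
    obtain ⟨y, rfl⟩ := mk_surjective U b
    obtain ⟨x, rfl, hx⟩ := exists_le_rep h
    obtain ⟨z, rfl⟩ := mk_surjective U c
    exact mk_le_mk_of_le (x := x + z) (y := y + z) fun i => add_le_add_left (hx i) _

instance instIsOrderedModule [IsOrderedModule ℝ E] : IsOrderedModule ℝ (Ultrapower U E) where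
  smul_le_smul_of_nonneg_left c hc a b h := by
    obtain ⟨y, rfl⟩ := mk_surjective U b
    obtain ⟨x, rfl, hx⟩ := exists_le_rep h
    exact mk_le_mk_of_le (x := c • x) (y := c • y) fun i =>
      smul_le_smul_of_nonneg_left (hx i) hc
  smul_le_smul_of_nonneg_right a ha c d h := by
    obtain ⟨x, rfl, hx⟩ := exists_ge_rep (x := 0) ha
    exact mk_le_mk_of_le (x := c • x) (y := d • x) fun i =>
      smul_le_smul_of_nonneg_right h (hx i)

theorem norm_mk_le_of_eventually {x : lp (fun _ : I => E) ∞} {C : ℝ} (hC : 0 ≤ C)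
    (h : ∀ᶠ i in (U : Filter I), ‖x i‖ ≤ C) : ‖mk U x‖ ≤ C := by
  classical
  let y : lp (fun _ : I => E) ∞ := ⟨fun i => if ‖x i‖ ≤ C then x i else 0, memℓp_infty ⟨C, by
    rintro _ ⟨i, rfl⟩
    dsimp only
    split_ifs with hi
    · exact hi
    · simpa using hC⟩⟩
  have hy : ∀ i, y i = if ‖x i‖ ≤ C then x i else 0 := fun i => rfl
  have hxy : mk U y = mk U x := by
    refine mk_eq_mk.2 (mem_nullSubmodule_iff.2 fun ε hε => ?_)
    filter_upwards [h] with i hi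
    simpa [hy, hi] using hε
  rw [← hxy]
  refine (norm_mk_le y).trans (lp.norm_le_of_forall_le hC fun i => ?_)
  rw [hy]
  split_ifs with hi
  · exact hi
  · simpa using hC

instance instHasSolidNorm : HasSolidNorm (Ultrapower U E) where
  solid a b h := by
    refine le_of_forall_pos_le_add fun ε hε => ?_
    obtain ⟨y, rfl, hy⟩ := exists_mk_eq_norm_lt b (half_pos hε)
    obtain ⟨x, rfl⟩ := mk_surjective U a
    obtain ⟨z, hz, h⟩ := (mk_le_mk (x := lpSup x (-x)) (y := lpSup y (-y))).1 h
    refine norm_mk_le_of_eventually (by positivity) ?_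
    filter_upwards [mem_nullSubmodule_iff.1 hz (ε / 2) (half_pos hε)] with i hi
    have h1 : |x i| + z i ≤ |y i| := h i
    have h2 : |x i| ≤ |(|y i| + |z i|)| := by
      rw [abs_of_nonneg (add_nonneg (abs_nonneg (y i)) (abs_nonneg (z i)))]
      have h3 : |x i| ≤ |y i| - z i := le_sub_iff_add_le.2 h1
      refine h3.trans ?_
      rw [sub_eq_add_neg]
      exact add_le_add_right (neg_le_abs _) _
    have h4 := (HasSolidNorm.solid h2).trans (norm_add_le _ _)
    rw [norm_abs_eq_norm, norm_abs_eq_norm] at h4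
    have h5 : ‖y i‖ ≤ ‖y‖ := lp.norm_apply_le_norm (by simp) y i
    change ‖x i‖ ≤ ‖mk U y‖ + ε
    have h6 : ‖y‖ < ‖mk U y‖ + ε / 2 := hy
    linarith

end Order

end Ultrapower

end Ultrapowers

/-! The proof replaces disjoint non-singularity, which concerns sequences, by a quantitative
condition on single vectors that survives ultrapowers. Let `e` be a weak unit. If `T` is DN-S, some
`r > 0` satisfies `‖T x‖ ≥ r` for every normalized `x` with `‖|x| ∧ e‖ < r`
(`exists_lower_bound_of_disjointlyNonSingular`). Otherwise a Kadec–Pełczyński argument builds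
normalized, almost disjoint vectors with `‖T x‖` summable. A disjoint perturbation of them spans a
subspace on which `T` is compact, hence strictly singular.

Only finitely many norm inequalities in one coordinate are needed to pass this condition to `T_U`,
with `r / 2` for `r` and the constant class of `e` for `e` (`Ultrapower.half_le_norm_map`). That
class need not be a weak unit of the ultrapower, and the argument does not need it to be one.

It remains to find vectors with small truncation in the span of a disjoint sequence of `E_U`. The
truncations of such a sequence by the class of `e` are disjoint and lie below it, so their finite
sums are bounded. Order continuity makes `[0, e]` uniformly exhaustive
(`exists_bound_of_norm_sum_le`), so the truncations cannot all be large
(`Ultrapower.exists_norm_abs_inf_const_lt`). Along a subsequence they have a small sum, and then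
every normalized vector of the span has small truncation. Hence `T_U` is bounded below there. -/

namespace BanachLattice

/-! ### Disjointness and truncation in vector lattices. -/

section LatticeGroup

variable {E : Type u} [AddCommGroup E] [Lattice E] [IsOrderedAddMonoid E]

theorem inf_add_le_add_inf {a b c : E} (ha : 0 ≤ a) (hb : 0 ≤ b) (hc : 0 ≤ c) :
    a ⊓ (b + c) ≤ a ⊓ b + a ⊓ c := by
  rw [inf_add, add_inf, add_inf]
  refine le_inf (le_inf ?_ ?_) (le_inf ?_ inf_le_right)
  · exact inf_le_left.trans (le_add_of_nonneg_right ha)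
  · exact inf_le_left.trans (le_add_of_nonneg_right hc)
  · exact inf_le_left.trans (le_add_of_nonneg_left hb)

theorem inf_sum_le_sum_inf {ι : Type*} (s : Finset ι) {a : E} {b : ι → E} (ha : 0 ≤ a)
    (hb : ∀ i, 0 ≤ b i) : a ⊓ ∑ i ∈ s, b i ≤ ∑ i ∈ s, a ⊓ b i := by
  classical
  induction s using Finset.induction_on with
  | empty => simp
  | insert j s hj ih =>
    rw [Finset.sum_insert hj, Finset.sum_insert hj]
    exact (inf_add_le_add_inf ha (hb j) (Finset.sum_nonneg fun i _ => hb i)).trans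
      (add_le_add_right ih _)

theorem abs_sum_le_sum_abs {ι : Type*} (s : Finset ι) (x : ι → E) :
    |∑ i ∈ s, x i| ≤ ∑ i ∈ s, |x i| :=
  Finset.le_sum_of_subadditive _ abs_zero.le abs_add_le _ _

/-- Translation commutes with infima. This is the source of exact disjointness in
`exists_disjoint_near`. -/
theorem sub_inf_disjoint (a b : E) : (a - a ⊓ b) ⊓ (b - a ⊓ b) = 0 := by
  rw [← inf_sub, sub_self]

theorem abs_inf_abs_eq_zero_of_le {x y x' y' : E} (h : |x| ⊓ |y| = 0) (hx : |x'| ≤ |x|)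
    (hy : |y'| ≤ |y|) : |x'| ⊓ |y'| = 0 :=
  le_antisymm ((inf_le_inf hx hy).trans h.le) (le_inf (abs_nonneg _) (abs_nonneg _))

theorem abs_inf_abs_sum_eq_zero {ι : Type*} (s : Finset ι) {x : E} {y : ι → E}
    (h : ∀ i ∈ s, |x| ⊓ |y i| = 0) : |x| ⊓ |∑ i ∈ s, y i| = 0 := by
  refine le_antisymm ?_ (le_inf (abs_nonneg _) (abs_nonneg _))
  calc |x| ⊓ |∑ i ∈ s, y i| ≤ |x| ⊓ ∑ i ∈ s, |y i| :=
        inf_le_inf_left _ (abs_sum_le_sum_abs s y)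
    _ ≤ ∑ i ∈ s, |x| ⊓ |y i| := inf_sum_le_sum_inf s (abs_nonneg _) fun i => abs_nonneg _
    _ = 0 := Finset.sum_eq_zero h

/-- Since `|x| ≤ |x + y| + |y|`, meeting with `|x|` and splitting the sum kills the contribution of
`|y|`. -/
theorem abs_le_abs_add_of_disjoint {x y : E} (h : |x| ⊓ |y| = 0) : |x| ≤ |x + y| := by
  have h1 : |x| ≤ |x + y| + |y| := by
    have := abs_add_le (x + y) (-y)
    rwa [add_neg_cancel_right, abs_neg] at this
  calc |x| = |x| ⊓ (|x + y| + |y|) := (inf_eq_left.2 h1).symm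
    _ ≤ |x| ⊓ |x + y| + |x| ⊓ |y| :=
        inf_add_le_add_inf (abs_nonneg _) (abs_nonneg _) (abs_nonneg _)
    _ ≤ |x + y| := by rw [h, add_zero]; exact inf_le_right

theorem abs_le_abs_sum_of_disjoint {ι : Type*} {s : Finset ι} {x : ι → E}
    (h : Pairwise fun i j => |x i| ⊓ |x j| = 0) {j : ι} (hj : j ∈ s) :
    |x j| ≤ |∑ i ∈ s, x i| := by
  classical
  rw [← Finset.add_sum_erase s x hj]
  exact abs_le_abs_add_of_disjoint
    (abs_inf_abs_sum_eq_zero _ fun i hi => h (Finset.ne_of_mem_erase hi).symm)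

/-- For disjoint positive vectors the sum is the supremum, because `a + b = a ∧ b + a ∨ b`. -/
theorem sum_le_of_disjoint {ι : Type*} (s : Finset ι) {x : ι → E} {e : E} (he : 0 ≤ e)
    (h : Pairwise fun i j => |x i| ⊓ |x j| = 0) (h0 : ∀ i, 0 ≤ x i) (hx : ∀ i, x i ≤ e) :
    ∑ i ∈ s, x i ≤ e := by
  classical
  induction s using Finset.induction_on with
  | empty => simpa using he
  | insert j s hj ih =>
    have h1 := abs_inf_abs_sum_eq_zero s (x := x j) (y := x)
      fun i hi => h (ne_of_mem_of_not_mem hi hj).symm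
    rw [abs_of_nonneg (h0 j), abs_of_nonneg (Finset.sum_nonneg fun i _ => h0 i)] at h1
    rw [Finset.sum_insert hj, ← inf_add_sup, h1, zero_add]
    exact sup_le (hx j) ih

end LatticeGroup

section OrderedModule

variable {E : Type u} [AddCommGroup E] [Module ℝ E] [Lattice E] [IsOrderedAddMonoid E]
  [IsOrderedModule ℝ E]

theorem abs_smul_of_nonneg {c : ℝ} (hc : 0 ≤ c) (x : E) : |c • x| = c • |x| := by
  rcases hc.eq_or_lt with rfl | hc
  · simp
  · have := (OrderIso.smulRight (β := E) hc).map_sup x (-x)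
    simp only [OrderIso.smulRight_apply, smul_neg] at this
    exact this.symm

theorem abs_smul_eq (c : ℝ) (x : E) : |c • x| = |c| • |x| := by
  rcases le_total 0 c with hc | hc
  · rw [abs_smul_of_nonneg hc, abs_of_nonneg hc]
  · rw [← abs_neg, ← neg_smul, abs_smul_of_nonneg (neg_nonneg.2 hc), abs_of_nonpos hc]

theorem inf_smul_le {t : ℝ} (ht : 1 ≤ t) {a : E} (ha : 0 ≤ a) (b : E) :
    a ⊓ t • b ≤ t • (a ⊓ b) := by
  have h := (OrderIso.smulRight (β := E) (zero_lt_one.trans_le ht)).map_inf a b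
  simp only [OrderIso.smulRight_apply] at h
  rw [h]
  exact inf_le_inf_right _ (le_smul_of_one_le_left ha ht)

theorem abs_inf_abs_smul_eq_zero {x y : E} (h : |x| ⊓ |y| = 0) (c : ℝ) :
    |x| ⊓ |c • y| = 0 := by
  refine le_antisymm ?_ (le_inf (abs_nonneg _) (abs_nonneg _))
  rw [abs_smul_eq]
  have h1 : |c| • |y| ≤ max 1 |c| • |y| :=
    smul_le_smul_of_nonneg_right (le_max_right _ _) (abs_nonneg _)
  refine (inf_le_inf_left _ h1).trans ((inf_smul_le (le_max_left _ _) (abs_nonneg _) _).trans ?_)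
  rw [h, smul_zero]

theorem pairwise_disjoint_smul {ι : Type*} {x : ι → E}
    (h : Pairwise fun i j => |x i| ⊓ |x j| = 0) (c : ι → ℝ) :
    Pairwise fun i j => |c i • x i| ⊓ |c j • x j| = 0 := by
  intro i j hij
  refine abs_inf_abs_smul_eq_zero ?_ _
  rw [inf_comm]
  refine abs_inf_abs_smul_eq_zero ?_ _
  rw [inf_comm]
  exact h hij

end OrderedModule

/-! ### Consequences of order continuity; positive functionals. -/

section Normed

variable {E : Type u} [NormedAddCommGroup E] [Lattice E] [HasSolidNorm E] [IsOrderedAddMonoid E]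

theorem norm_le_norm_of_nonneg_of_le {a b : E} (ha : 0 ≤ a) (h : a ≤ b) : ‖a‖ ≤ ‖b‖ :=
  norm_le_norm_of_abs_le_abs (by rwa [abs_of_nonneg ha, abs_of_nonneg (ha.trans h)])

/-- In an order continuous Banach lattice, increasing order bounded sequences converge. -/
theorem exists_tendsto_of_monotone [CompleteSpace E] [NormedSpace ℝ E] [IsOrderedModule ℝ E]
    (hE : OrderContinuousNorm E) {x : ℕ → E} (hx : Monotone x) {b : E} (hb : ∀ n, x n ≤ b) :
    ∃ y, Filter.Tendsto x Filter.atTop (nhds y) := by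
  -- No supremum of `x` is known to exist, so order continuity is applied to the differences `v - x
  -- n`, with `v` running downwards through all upper bounds.
  let V : Type u := {v : E // ∀ n, x n ≤ v}
  have : Nonempty V := ⟨⟨b, hb⟩⟩
  have : IsDirectedOrder (Vᵒᵈ × ULift.{u} ℕ) := ⟨fun p q =>
    ⟨(OrderDual.toDual ⟨p.1.ofDual.1 ⊓ q.1.ofDual.1,
        fun n => le_inf (p.1.ofDual.2 n) (q.1.ofDual.2 n)⟩, ⟨max p.2.down q.2.down⟩),
      ⟨(inf_le_left : p.1.ofDual.1 ⊓ q.1.ofDual.1 ≤ _), (le_max_left _ _ : p.2.down ≤ _)⟩,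
      ⟨(inf_le_right : p.1.ofDual.1 ⊓ q.1.ofDual.1 ≤ _), (le_max_right _ _ : q.2.down ≤ _)⟩⟩⟩
  let f : Vᵒᵈ × ULift.{u} ℕ → E := fun p => p.1.ofDual.1 - x p.2.down
  have hf : Antitone f := fun p q h => sub_le_sub (h.1 : q.1.ofDual.1 ≤ p.1.ofDual.1) (hx h.2)
  have hglb : IsGLB (Set.range f) 0 := by
    refine ⟨?_, fun w hw => ?_⟩
    · rintro _ ⟨p, rfl⟩
      exact sub_nonneg.2 (p.1.ofDual.2 _)
    · have h1 : ∀ (v : V) n, w ≤ v.1 - x n := fun v n => hw ⟨(OrderDual.toDual v, ⟨n⟩), rfl⟩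
      -- Subtracting `w` from an upper bound gives an upper bound. Iterating from `b` bounds every
      -- multiple `k • w` by `b - x 0`, which forces `w ≤ 0` by the Archimedean property.
      have h2 : ∀ k : ℕ, ∀ n, x n ≤ b - k • w := by
        intro k
        induction k with
        | zero => simpa using hb
        | succ k ih =>
          intro n
          have h3 := h1 ⟨b - k • w, ih⟩ n
          rw [succ_nsmul, ← sub_sub]
          exact le_sub_comm.1 h3
      have h4 : ∀ k : ℕ, k • w ≤ b - x 0 := fun k => le_sub_comm.1 (h2 k 0)
      have h5 : ∀ k : ℕ, w ≤ (1 / ((k : ℝ) + 1)) • (b - x 0) := by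
        intro k
        have hk : (0 : ℝ) < (k : ℝ) + 1 := by positivity
        have h6 := smul_le_smul_of_nonneg_left (h4 (k + 1)) (one_div_pos.2 hk).le
        rw [← Nat.cast_smul_eq_nsmul ℝ, smul_smul, Nat.cast_succ, one_div_mul_cancel hk.ne',
          one_smul] at h6
        exact h6
      have h7 := (tendsto_one_div_add_atTop_nhds_zero_nat (𝕜 := ℝ)).smul_const (b - x 0)
      rw [zero_smul] at h7
      exact ge_of_tendsto' h7 h5
  have h := hE _ f hf hglb
  have hc : CauchySeq x := by
    rw [Metric.cauchySeq_iff']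
    intro ε hε
    obtain ⟨p, hp⟩ := (Metric.tendsto_nhds.1 h ε hε).exists
    rw [dist_zero_right] at hp
    refine ⟨p.2.down, fun n hn => ?_⟩
    rw [dist_eq_norm]
    exact (norm_le_norm_of_nonneg_of_le (sub_nonneg.2 (hx hn))
      (sub_le_sub_right (p.1.ofDual.2 n) _)).trans_lt hp
  exact cauchySeq_tendsto_of_complete hc

theorem exists_tendsto_of_antitone [CompleteSpace E] [NormedSpace ℝ E] [IsOrderedModule ℝ E]
    (hE : OrderContinuousNorm E) {x : ℕ → E} (hx : Antitone x) {b : E} (hb : ∀ n, b ≤ x n) :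
    ∃ y, Filter.Tendsto x Filter.atTop (nhds y) := by
  obtain ⟨y, hy⟩ := exists_tendsto_of_monotone hE (x := fun n => -x n)
    (fun m n h => neg_le_neg (hx h)) (b := -b) fun n => neg_le_neg (hb n)
  exact ⟨-y, by simpa using hy.neg⟩

/-- A weak unit of an order continuous Banach lattice is a quasi-interior point. -/
theorem tendsto_inf_nsmul_weakUnit [CompleteSpace E] [NormedSpace ℝ E] [IsOrderedModule ℝ E]
    (hE : OrderContinuousNorm E) {e : E} (he : IsWeakUnit e) (a : E) :
    Filter.Tendsto (fun m : ℕ => a ⊓ m • e) Filter.atTop (nhds a) := by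
  obtain ⟨w, hw⟩ := exists_tendsto_of_monotone hE (x := fun m : ℕ => a ⊓ m • e)
    (fun m n h => inf_le_inf_left _ (nsmul_le_nsmul_left he.1 h)) (b := a) fun n => inf_le_left
  have hmono : Monotone (fun m : ℕ => a ⊓ m • e) :=
    fun m n h => inf_le_inf_left _ (nsmul_le_nsmul_left he.1 h)
  have hwa : w ≤ a := le_of_tendsto' hw fun n => inf_le_left
  have hle : ∀ m : ℕ, a ⊓ m • e ≤ w := fun m => hmono.ge_of_tendsto hw m
  -- Adding `p` to `a ⊓ m • e` stays below `a ⊓ (m + 1) • e`, so in the limit `w + p ≤ w` and `p`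
  -- vanishes.
  set p := (a - w) ⊓ e with hp
  have hp0 : 0 ≤ p := le_inf (sub_nonneg.2 hwa) he.1
  have hstep : ∀ m : ℕ, a ⊓ m • e + p ≤ w := by
    intro m
    refine le_trans (le_inf ?_ ?_) (hle (m + 1))
    · calc a ⊓ m • e + p ≤ w + (a - w) := add_le_add (hle m) inf_le_left
        _ = a := by abel
    · rw [succ_nsmul]
      exact add_le_add inf_le_right inf_le_right
  have hlim : w + p ≤ w := le_of_tendsto' (hw.add_const p) hstep
  have hpz : p = 0 := le_antisymm (by simpa using hlim) hp0
  have haw : a - w = 0 := by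
    refine he.2 _ ?_
    rw [abs_of_nonneg (sub_nonneg.2 hwa), ← hp, hpz, norm_zero]
  rwa [← sub_eq_zero.1 haw] at hw

/-- Every positive vector is normed by a positive functional of norm at most one. -/
theorem exists_positive_functional [NormedSpace ℝ E] [IsOrderedModule ℝ E] {d : E}
    (hd : 0 ≤ d) :
    ∃ φ : E →L[ℝ] ℝ, (∀ x, 0 ≤ x → 0 ≤ φ x) ∧ (∀ x, |φ x| ≤ ‖x‖) ∧ φ d = ‖d‖ := by
  rcases eq_or_ne d 0 with rfl | hd0
  · exact ⟨0, by simp⟩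
  -- Hahn–Banach with the norm of the positive part as majorant: it vanishes on negative vectors,
  -- which makes the extension positive.
  obtain ⟨g, hg1, hg2⟩ := exists_extension_of_le_sublinear
    (LinearPMap.mkSpanSingleton d ‖d‖ hd0) (fun x => ‖x ⊔ 0‖)
    (by
      intro c hc x
      have h := (OrderIso.smulRight (β := E) hc).map_sup x 0
      simp only [OrderIso.smulRight_apply, smul_zero] at h
      rw [← h, norm_smul, Real.norm_of_nonneg hc.le])
    (by
      intro x y
      refine le_trans ?_ (norm_add_le _ _)
      exact norm_le_norm_of_nonneg_of_le le_sup_right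
        (sup_le (add_le_add le_sup_left le_sup_left) (add_nonneg le_sup_right le_sup_right)))
    (by
      rintro ⟨x, hx⟩
      obtain ⟨c, rfl⟩ := Submodule.mem_span_singleton.1 hx
      refine (LinearPMap.mkSpanSingleton'_apply d ‖d‖ _ c hx).trans_le ?_
      rcases le_total 0 c with hc | hc
      · simp only
        rw [sup_eq_left.2 (smul_nonneg hc hd), norm_smul, Real.norm_of_nonneg hc, smul_eq_mul,
          RingHom.id_apply]
      · exact (mul_nonpos_of_nonpos_of_nonneg hc (norm_nonneg d)).trans (norm_nonneg _))
  have hup : ∀ x, g x ≤ ‖x‖ := fun x => (hg2 x).trans (by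
    refine norm_le_norm_of_abs_le_abs ?_
    rw [abs_of_nonneg (le_sup_right : (0 : E) ≤ x ⊔ 0)]
    exact sup_le (le_abs_self x) (abs_nonneg x))
  have habs : ∀ x, |g x| ≤ ‖x‖ := fun x => abs_le'.2 ⟨hup x, by simpa using hup (-x)⟩
  refine ⟨g.mkContinuous 1 fun x => by simpa using habs x, fun x hx => ?_, fun x => habs x, ?_⟩
  · have h := hg2 (-x)
    rw [sup_eq_right.2 (neg_nonpos.2 hx), norm_zero, map_neg, neg_nonpos] at h
    exact h
  · have h := hg1 ⟨d, Submodule.mem_span_singleton_self d⟩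
    rw [LinearPMap.mkSpanSingleton_apply] at h
    exact h

theorem countable_supClosure {α : Type*} [SemilatticeSup α] {s : Set α} (hs : s.Countable) :
    (supClosure s).Countable := by
  have := hs.to_subtype
  refine (Set.countable_range fun t : {t : Finset s // t.Nonempty} =>
    t.1.sup' t.2 (Subtype.val : s → α)).mono ?_
  refine supClosure_min (fun a ha => ⟨⟨{⟨a, ha⟩}, by simp⟩, by simp⟩) ?_
  classical
  rintro _ ⟨t, rfl⟩ _ ⟨t', rfl⟩
  exact ⟨⟨t.1 ∪ t'.1, t.2.mono Finset.subset_union_left⟩, Finset.sup'_union t.2 t'.2 _⟩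

end Normed

/-! ### Uniform exhaustion of order intervals. -/

section UniformExhaustion

theorem map_le_map_of_nonneg {E : Type u} [NormedAddCommGroup E] [NormedSpace ℝ E] [Lattice E]
    [IsOrderedAddMonoid E] {φ : E →L[ℝ] ℝ} (hφ : ∀ x, 0 ≤ x → 0 ≤ φ x) {a b : E} (h : a ≤ b) :
    φ a ≤ φ b := by
  have := hφ _ (sub_nonneg.2 h)
  rwa [map_sub, sub_nonneg] at this

variable {E : Type u} [NormedAddCommGroup E] [NormedSpace ℝ E] [CompleteSpace E] [Lattice E]
  [HasSolidNorm E] [IsOrderedAddMonoid E] [IsOrderedModule ℝ E]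

/-- A sequence in an order interval of an order continuous Banach lattice that is small for each
member of a family of positive functionals separating the relevant suprema is not bounded away
from zero. -/
theorem not_forall_le_norm_of_functionals (hE : OrderContinuousNorm E) {e : E} {ε : ℝ} (hε : 0 < ε)
    {D : Set E} (hD : SupClosed D) {d : ℕ → E} (hd : D ⊆ Set.range d) {φ : ℕ → E →L[ℝ] ℝ}
    (hφ0 : ∀ i x, 0 ≤ x → 0 ≤ φ i x) (hφ1 : ∀ i x, |φ i x| ≤ ‖x‖)
    (hφd : ∀ i, d i ∈ D → φ i (d i) = ‖d i‖)
    {x : ℕ → E} (hxD : ∀ n, x n ∈ D) (hx0 : ∀ n, 0 ≤ x n) (hxe : ∀ n, x n ≤ e)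
    (hsmall : ∀ n, ∀ i < n, φ i (x n) ≤ (1 / 2) ^ n) : ¬ ∀ n, ε ≤ ‖x n‖ := by
  intro hnorm
  -- The limits of these suprema in `n` are the tail suprema `y m`, which decrease to the upper
  -- limit `z` of the sequence. The aim is `z = 0`.
  let s : ℕ → ℕ → E := fun m => partialSups fun k => x (m + k)
  have hs_le : ∀ m n, s m n ≤ e := fun m n => partialSups_le _ _ _ fun k _ => hxe _
  have hs_ge : ∀ m n, x m ≤ s m n := fun m n => by
    simpa using le_partialSups_of_le (fun k => x (m + k)) (Nat.zero_le n)
  have hsD : ∀ m n, s m n ∈ D := by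
    intro m n
    induction n with
    | zero => simpa [s] using hxD m
    | succ n ih =>
      have : s m (n + 1) = s m n ⊔ x (m + (n + 1)) := partialSups_add_one _ _
      rw [this]
      exact hD ih (hxD _)
  -- The supremum is at most the sum, and the right side is the geometric sum from `m` to `m + n`.
  have hsφ : ∀ m n, ∀ i < m, φ i (s m n) ≤ 2 * (1 / 2) ^ m - (1 / 2) ^ (m + n) := by
    intro m n i hi
    induction n with
    | zero =>
      have := hsmall m i hi
      simp only [s, partialSups_zero, add_zero]
      linarith
    | succ n ih =>
      have h1 : s m (n + 1) = s m n ⊔ x (m + (n + 1)) := partialSups_add_one _ _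
      have h2 : s m (n + 1) ≤ s m n + x (m + (n + 1)) := by
        rw [h1]
        exact sup_le (le_add_of_nonneg_right (hx0 _))
          (le_add_of_nonneg_left ((hx0 m).trans (hs_ge m n)))
      have h3 := map_le_map_of_nonneg (hφ0 i) h2
      rw [map_add] at h3
      have h4 := hsmall (m + (n + 1)) i (by omega)
      have h5 : ((1 : ℝ) / 2) ^ (m + n) = 2 * (1 / 2) ^ (m + (n + 1)) := by
        rw [← add_assoc, pow_succ]; ring
      linarith
  have hs_anti : ∀ m n, s (m + 1) n ≤ s m (n + 1) := by
    intro m n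
    refine partialSups_le _ _ _ fun k hk => ?_
    have := le_partialSups_of_le (fun k => x (m + k)) (Nat.succ_le_succ hk)
    rwa [show m + 1 + k = m + (k + 1) by omega]
  choose y hy using fun m => exists_tendsto_of_monotone hE (partialSups fun k => x (m + k)).monotone
    (hs_le m)
  have hy0 : ∀ m, x m ≤ y m := fun m => ge_of_tendsto' (hy m) (hs_ge m)
  have hyanti : Antitone y := antitone_nat_of_succ_le fun m =>
    le_of_tendsto_of_tendsto' (hy (m + 1)) ((hy m).comp (Filter.tendsto_add_atTop_nat 1))
      (hs_anti m)
  obtain ⟨z, hz⟩ := exists_tendsto_of_antitone hE hyanti fun m => (hx0 m).trans (hy0 m)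
  have hzD : z ∈ closure D := isClosed_closure.mem_of_tendsto hz <| Filter.Eventually.of_forall
    fun m => mem_closure_of_tendsto (hy m) (Filter.Eventually.of_forall (hsD m))
  have hzφ : ∀ i, φ i z ≤ 0 := by
    intro i
    have h1 : ∀ᶠ m in Filter.atTop, φ i (y m) ≤ 2 * (1 / 2) ^ m := by
      filter_upwards [Filter.eventually_gt_atTop i] with m hm
      refine le_of_tendsto' (((φ i).continuous.tendsto _).comp (hy m)) fun n => ?_
      have := hsφ m n i hm
      have h2 : (0 : ℝ) ≤ (1 / 2) ^ (m + n) := by positivity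
      exact this.trans (by linarith)
    have h3 : Filter.Tendsto (fun m : ℕ => 2 * ((1 : ℝ) / 2) ^ m) Filter.atTop (nhds 0) := by
      simpa using (tendsto_pow_atTop_nhds_zero_of_lt_one (r := (1 : ℝ) / 2) (by norm_num)
        (by norm_num)).const_mul 2
    exact le_of_tendsto_of_tendsto (((φ i).continuous.tendsto _).comp hz) h3 h1
  have hz0 : z = 0 := by
    rw [← norm_le_zero_iff]
    refine le_of_forall_pos_le_add fun δ hδ => ?_
    -- A member `d i` of `D` close to `z` is normed by `φ i`, which is nonpositive at `z`; so `d i`,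
    -- and with it `z`, is small.
    obtain ⟨a, ha, haz⟩ := Metric.mem_closure_iff.1 hzD (δ / 2) (half_pos hδ)
    obtain ⟨i, rfl⟩ := hd ha
    rw [dist_eq_norm] at haz
    have h1 := (le_abs_self _).trans (hφ1 i (d i - z))
    rw [map_sub, hφd i ha, norm_sub_rev] at h1
    have h2 := norm_le_norm_add_norm_sub' z (d i)
    have := hzφ i
    linarith
  rw [hz0] at hz
  have h1 := hz.norm
  rw [norm_zero] at h1
  have h2 : ε ≤ 0 := ge_of_tendsto' h1 fun m =>
    (hnorm m).trans (norm_le_norm_of_nonneg_of_le (hx0 m) (hy0 m))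
  exact absurd h2 (not_le.2 hε)

/-- Order intervals of an order continuous Banach lattice are uniformly exhaustive: only boundedly
many of their members with bounded sum can have norm at least `ε`. -/
theorem exists_bound_of_norm_sum_le (hE : OrderContinuousNorm E) (e : E) (C : ℝ) {ε : ℝ}
    (hε : 0 < ε) :
    ∃ N : ℕ, ∀ x : ℕ → E, (∀ k, 0 ≤ x k) → (∀ k, x k ≤ e) →
      ‖∑ k ∈ Finset.range N, x k‖ ≤ C → ∃ k < N, ‖x k‖ < ε := by
  by_contra! hcon
  choose x hx0 hxe hxC hxε using hcon
  let S : Set E := Set.range fun p : ℕ × ℕ => x p.1 p.2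
  have hS : (supClosure S).Countable := countable_supClosure (Set.countable_range _)
  have hS0 : ∀ a ∈ supClosure S, 0 ≤ a := by
    have : supClosure S ⊆ Set.Ici 0 := supClosure_min
      (by rintro _ ⟨p, rfl⟩; exact hx0 p.1 p.2) fun a ha b _ => le_sup_of_le_left ha
    exact this
  obtain ⟨d, hd⟩ := hS.exists_eq_range ⟨_, subset_supClosure ⟨(0, 0), rfl⟩⟩
  have hd0 : ∀ i, 0 ≤ d i := fun i => hS0 _ (hd ▸ Set.mem_range_self i)
  choose φ hφ0 hφ1 hφd using fun i => exists_positive_functional (hd0 i)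
  have hpick : ∀ n : ℕ, ∃ p : ℕ × ℕ, p.2 < p.1 ∧ ∀ i < n, φ i (x p.1 p.2) ≤ (1 / 2) ^ n := by
    intro n
    -- Pigeonhole: the first `n` functionals have total mass at most `n * C` on the `N`-th family,
    -- so for such `N` not every member can have one value above `(1 / 2) ^ n`.
    obtain ⟨N, hN⟩ := exists_nat_gt (n * C / (1 / 2 : ℝ) ^ n)
    by_contra! hno
    have h1 : ∀ k < N, (1 / 2 : ℝ) ^ n ≤ ∑ i ∈ Finset.range n, φ i (x N k) := by
      intro k hk
      obtain ⟨i, hi, h⟩ := hno (N, k) hk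
      exact h.le.trans (Finset.single_le_sum (f := fun i => φ i (x N k))
        (fun i _ => hφ0 i _ (hx0 N k)) (Finset.mem_range.2 hi))
    have h2 : (N : ℝ) * (1 / 2 : ℝ) ^ n ≤ n * C := by
      calc (N : ℝ) * (1 / 2 : ℝ) ^ n = ∑ k ∈ Finset.range N, (1 / 2 : ℝ) ^ n := by simp
        _ ≤ ∑ k ∈ Finset.range N, ∑ i ∈ Finset.range n, φ i (x N k) :=
            Finset.sum_le_sum fun k hk => h1 k (Finset.mem_range.1 hk)
        _ = ∑ i ∈ Finset.range n, φ i (∑ k ∈ Finset.range N, x N k) := by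
            rw [Finset.sum_comm]; simp
        _ ≤ ∑ i ∈ Finset.range n, C := Finset.sum_le_sum fun i _ =>
            ((le_abs_self _).trans (hφ1 i _)).trans (hxC N)
        _ = n * C := by simp
    rw [div_lt_iff₀ (by positivity)] at hN
    linarith
  choose p hp hpφ using hpick
  exact not_forall_le_norm_of_functionals hE hε supClosed_supClosure hd.le hφ0 hφ1
    (fun i _ => hφd i) (x := fun n => x (p n).1 (p n).2)
    (fun n => subset_supClosure ⟨p n, rfl⟩) (fun n => hx0 _ _) (fun n => hxe _ _) hpφ
    fun n => hxε _ _ (hp n)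

end UniformExhaustion

/-! ### Perturbing almost disjoint sequences. -/

section Disjointification

variable {E : Type u} [NormedAddCommGroup E] [CompleteSpace E] [Lattice E]
  [HasSolidNorm E] [IsOrderedAddMonoid E]

/-- An almost disjoint sequence is a small perturbation of a disjoint one. -/
theorem exists_disjoint_near {x : ℕ → E} {η : ℝ} (hη : 0 ≤ η)
    (h : ∀ i j, i ≠ j → ‖|x i| ⊓ |x j|‖ ≤ η * ((1 / 2) ^ i * (1 / 2) ^ j)) :
    ∃ d : ℕ → E, IsDisjointSeq d ∧ ∀ j, ‖x j - d j‖ ≤ 4 * η * (1 / 2) ^ j := by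
  classical
  let a : ℕ → ℕ → E := fun j i => if i = j then 0 else |x i| ⊓ |x j|
  have ha0 : ∀ j i, 0 ≤ a j i := by
    intro j i
    dsimp only [a]
    split_ifs
    · exact le_rfl
    · exact le_inf (abs_nonneg _) (abs_nonneg _)
  have hgeo : ∀ j : ℕ, HasSum (fun i : ℕ => η * (1 / 2 : ℝ) ^ j * (1 / 2) ^ i)
      (η * (1 / 2 : ℝ) ^ j * 2) := fun j => hasSum_geometric_two.mul_left _
  have hbound : ∀ j i, ‖a j i‖ ≤ η * (1 / 2 : ℝ) ^ j * (1 / 2) ^ i := by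
    intro j i
    dsimp only [a]
    split_ifs with hij
    · rw [norm_zero]; positivity
    · exact (h i j hij).trans (le_of_eq (by ring))
  have hsum : ∀ j, Summable (a j) := fun j =>
    Summable.of_norm_bounded (hgeo j).summable (hbound j)
  let w : ℕ → E := fun j => ∑' i, a j i
  have hw : ∀ j, ‖w j‖ ≤ η * (1 / 2 : ℝ) ^ j * 2 := fun j =>
    tsum_of_norm_bounded (hgeo j) (hbound j)
  have hw0 : ∀ j, 0 ≤ w j := fun j => tsum_nonneg (ha0 j)
  have haw : ∀ i j, i ≠ j → |x i| ⊓ |x j| ≤ w j := by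
    intro i j hij
    have := (hsum j).le_tsum i fun k _ => ha0 j k
    simpa [a, hij] using this
  -- Here `w j` dominates every overlap of `|x j|` with another term. Removing it makes the moduli
  -- disjoint by `sub_inf_disjoint`.
  let b : ℕ → E := fun j => (|x j| - w j) ⊔ 0
  have hb0 : ∀ j, 0 ≤ b j := fun j => le_sup_right
  have hbx : ∀ j, |x j| - b j ≤ w j := fun j => by
    rw [sub_le_comm]
    exact le_sup_left
  have hbd : ∀ i j, i ≠ j → b i ⊓ b j = 0 := by
    intro i j hij
    refine le_antisymm ?_ (le_inf (hb0 i) (hb0 j))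
    rw [← sub_inf_disjoint |x i| |x j|]
    refine inf_le_inf (sup_le ?_ (sub_nonneg.2 inf_le_left)) (sup_le ?_ (sub_nonneg.2 inf_le_right))
    · refine sub_le_sub_left ?_ _
      rw [inf_comm]
      exact haw j i hij.symm
    · exact sub_le_sub_left (haw i j hij) _
  have hdist : ∀ (j : ℕ) (t : E), t ≤ |x j| → ‖t - t ⊓ b j‖ ≤ ‖w j‖ := by
    intro j t ht
    refine norm_le_norm_of_nonneg_of_le (sub_nonneg.2 inf_le_left) ?_
    rw [sub_inf, sub_self]
    exact sup_le (hw0 j) ((sub_le_sub_right ht _).trans (hbx j))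
  -- Truncating both parts of `x j` by `b j` restores the signs; each part moves by at most `‖w j‖`,
  -- hence the constant `4`.
  refine ⟨fun j => (x j)⁺ ⊓ b j - (x j)⁻ ⊓ b j, fun i j hij => ?_, fun j => ?_⟩
  · have hle : ∀ j, |(x j)⁺ ⊓ b j - (x j)⁻ ⊓ b j| ≤ |b j| := by
      intro j
      rw [abs_of_nonneg (hb0 j)]
      refine abs_le'.2 ⟨?_, ?_⟩
      · exact (sub_le_self _ (le_inf (negPart_nonneg _) (hb0 j))).trans inf_le_right
      · rw [neg_sub]
        exact (sub_le_self _ (le_inf (posPart_nonneg _) (hb0 j))).trans inf_le_right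
    refine abs_inf_abs_eq_zero_of_le ?_ (hle i) (hle j)
    rw [abs_of_nonneg (hb0 i), abs_of_nonneg (hb0 j)]
    exact hbd i j hij
  · have h1 := hdist j (x j)⁺ (sup_le (le_abs_self _) (abs_nonneg _))
    have h2 := hdist j (x j)⁻ (sup_le (neg_le_abs _) (abs_nonneg _))
    have h3 : x j - ((x j)⁺ ⊓ b j - (x j)⁻ ⊓ b j) =
        ((x j)⁺ - (x j)⁺ ⊓ b j) - ((x j)⁻ - (x j)⁻ ⊓ b j) := by
      nth_rewrite 1 [← posPart_sub_negPart (x j)]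
      abel
    rw [h3]
    refine (norm_sub_le _ _).trans ?_
    have := hw j
    linarith

end Disjointification

/-! ### Strict singularity on spans of disjoint sequences. -/

/-- Compact operators are strictly singular. -/
theorem strictlySingular_of_isCompact {X : Type u} {Y : Type v} [NormedAddCommGroup X]
    [NormedSpace ℝ X] [NormedAddCommGroup Y] [NormedSpace ℝ Y] {A : X →L[ℝ] Y}
    (h : ∀ R : ℝ, ∃ K : Set Y, IsCompact K ∧ ∀ x, ‖x‖ ≤ R → A x ∈ K) : StrictlySingular A := by
  rintro ⟨M, -, hM, hA⟩
  -- Riesz: a bounded sequence with mutual distances at least `1`. Its images have a convergent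
  -- subsequence, and an embedding would force consecutive differences in `M` to vanish in the
  -- limit.
  obtain ⟨R, f, -, hfR, hf⟩ := exists_seq_norm_le_one_le_norm_sub (𝕜 := ℝ) hM
  obtain ⟨K, hK, hAK⟩ := h R
  obtain ⟨y, -, ψ, hψ, hy⟩ := hK.tendsto_subseq (x := fun n => A (f n)) fun n => hAK _ (hfR n)
  have h1 : Filter.Tendsto (fun n => A.domRestrict M (f (ψ (n + 1)) - f (ψ n))) Filter.atTop
      (nhds (A.domRestrict M 0)) := by
    have := (hy.comp (Filter.tendsto_add_atTop_nat 1)).sub hy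
    rw [sub_self] at this
    simpa using this
  have h2 := (hA.isInducing.tendsto_nhds_iff (f := fun n => f (ψ (n + 1)) - f (ψ n))).2 h1
  have h3 : (1 : ℝ) ≤ 0 := by
    have h4 := h2.norm
    rw [norm_zero] at h4
    exact ge_of_tendsto' h4 fun n => hf (hψ.injective.ne (Nat.succ_ne_self n))
  linarith

section

variable {E : Type u} {Y : Type v} [NormedAddCommGroup E] [NormedSpace ℝ E]
  [Lattice E] [HasSolidNorm E] [IsOrderedAddMonoid E] [IsOrderedModule ℝ E]
  [NormedAddCommGroup Y] [NormedSpace ℝ Y]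

theorem norm_smul_le_norm_sum {ι : Type*} {s : Finset ι} {x : ι → E}
    (h : Pairwise fun i j => |x i| ⊓ |x j| = 0) (a : ι → ℝ) {j : ι} (hj : j ∈ s) :
    ‖a j • x j‖ ≤ ‖∑ i ∈ s, a i • x i‖ :=
  norm_le_norm_of_abs_le_abs (abs_le_abs_sum_of_disjoint (pairwise_disjoint_smul h a) hj)

/-- Smallness of the truncation by `e` passes to any positive `u` that is nearly below a multiple of
`e`. The factor is `m + 1` because `inf_smul_le` needs a scalar at least `1`. -/
theorem norm_abs_inf_le {e u x : E} (hu : 0 ≤ u) (he : 0 ≤ e) (m : ℕ) :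
    ‖|x| ⊓ u‖ ≤ ((m : ℝ) + 1) * ‖|x| ⊓ e‖ + ‖u - u ⊓ m • e‖ := by
  have hm : (1 : ℝ) ≤ (m : ℝ) + 1 := by linarith [(Nat.cast_nonneg m : (0 : ℝ) ≤ m)]
  have h1 : |x| ⊓ u ≤ ((m : ℝ) + 1) • (|x| ⊓ e) + (u - u ⊓ m • e) := by
    have h2 : 0 ≤ u ⊓ m • e := le_inf hu (nsmul_nonneg he m)
    have h3 : 0 ≤ u - u ⊓ m • e := sub_nonneg.2 inf_le_left
    calc |x| ⊓ u = |x| ⊓ (u ⊓ m • e + (u - u ⊓ m • e)) := by rw [add_sub_cancel]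
      _ ≤ |x| ⊓ (u ⊓ m • e) + |x| ⊓ (u - u ⊓ m • e) := inf_add_le_add_inf (abs_nonneg _) h2 h3
      _ ≤ |x| ⊓ ((m : ℝ) + 1) • e + (u - u ⊓ m • e) := by
          refine add_le_add (inf_le_inf_left _ (inf_le_right.trans ?_)) inf_le_right
          rw [add_smul, one_smul, Nat.cast_smul_eq_nsmul]
          exact le_add_of_nonneg_right he
      _ ≤ _ := add_le_add_left (inf_smul_le hm (abs_nonneg _) _) _
  refine (norm_le_norm_of_nonneg_of_le (le_inf (abs_nonneg _) hu) h1).trans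
    ((norm_add_le _ _).trans ?_)
  rw [norm_smul, Real.norm_of_nonneg (by positivity)]

/-- An operator that is summable along a seminormalized disjoint sequence is strictly singular on
its closed span. -/
theorem strictlySingular_of_summable [CompleteSpace Y] (T : E →L[ℝ] Y) {d : ℕ → E}
    (hd : IsDisjointSeq d) (hd2 : ∀ n, 1 / 2 ≤ ‖d n‖) (hT : Summable fun n => ‖T (d n)‖) :
    StrictlySingular (T.domRestrict (closedSpanSeq d)) := by
  refine strictlySingular_of_isCompact fun R => ?_
  -- Since `‖d n‖ ≥ 1 / 2`, vectors of the span of norm below `R + 1` have coefficients bounded by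
  -- `c`. Summability then makes their images lie in a continuous image of a compact product of
  -- intervals.
  let c : ℝ := 2 * (R + 1)
  let K : Set Y := (fun a : ℕ → ℝ => ∑' n, a n • T (d n)) ''
    Set.pi Set.univ fun _ => Set.Icc (-c) c
  have hK : IsCompact K := by
    refine (isCompact_univ_pi fun _ => isCompact_Icc).image_of_continuousOn ?_
    refine continuousOn_tsum (u := fun n => |c| * ‖T (d n)‖) (fun n => ?_) (hT.mul_left _) ?_
    · exact ((continuous_apply n).smul continuous_const).continuousOn
    · intro n a ha
      rw [norm_smul]
      refine mul_le_mul_of_nonneg_right ?_ (norm_nonneg _)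
      have := ha n (Set.mem_univ n)
      exact (abs_le.2 this).trans (le_abs_self c)
  refine ⟨K, hK, ?_⟩
  rintro ⟨g, hg⟩ hgR
  change T g ∈ K
  have hmaps : Set.MapsTo T (Metric.ball 0 (R + 1) ∩ Submodule.span ℝ (Set.range d)) K := by
    rintro g' ⟨hg1, hg2⟩
    obtain ⟨a, rfl⟩ := (Finsupp.mem_span_range_iff_exists_finsupp).1 hg2
    rw [mem_ball_zero_iff, Finsupp.sum] at hg1
    refine ⟨a, fun n _ => ?_, ?_⟩
    · rw [Set.mem_Icc, ← abs_le]
      have h0 : 0 ≤ ‖∑ i ∈ a.support, a i • d i‖ := norm_nonneg _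
      by_cases hn : n ∈ a.support
      · have h1 := norm_smul_le_norm_sum hd a hn
        rw [norm_smul, Real.norm_eq_abs] at h1
        have h2 := mul_le_mul_of_nonneg_left (hd2 n) (abs_nonneg (a n))
        simp only [c]
        linarith
      · rw [Finsupp.notMem_support_iff.1 hn, abs_zero]
        simp only [c]
        linarith
    · dsimp only
      rw [tsum_eq_sum (s := a.support), Finsupp.sum, map_sum]
      · simp
      · intro n hn
        rw [Finsupp.notMem_support_iff.1 hn, zero_smul]
  -- The extra `1` in the radius puts `g` inside an open ball, so it can be approximated from the
  -- span without leaving the ball.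
  have hgcl : g ∈ closure (Metric.ball 0 (R + 1) ∩ (Submodule.span ℝ (Set.range d) : Set E)) := by
    refine Metric.isOpen_ball.inter_closure ⟨?_, hg⟩
    rw [mem_ball_zero_iff]
    have : ‖g‖ ≤ R := hgR
    linarith
  have := map_mem_closure T.continuous hgcl hmaps
  rwa [hK.isClosed.closure_eq] at this

end

/-! ### The lower bound on vectors with small truncation. -/

section

variable {E : Type u} {Y : Type v} [NormedAddCommGroup E] [NormedSpace ℝ E] [CompleteSpace E]
  [Lattice E] [HasSolidNorm E] [IsOrderedAddMonoid E] [IsOrderedModule ℝ E]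
  [NormedAddCommGroup Y] [NormedSpace ℝ Y] [CompleteSpace Y]

/-- A disjointly non-singular operator is bounded below on the normalized vectors whose truncation
by a weak unit is small. -/
theorem exists_lower_bound_of_disjointlyNonSingular (hE : OrderContinuousNorm E) {e : E}
    (he : IsWeakUnit e) {T : E →L[ℝ] Y} (hT : DisjointlyNonSingular T) :
    ∃ r > 0, ∀ x, ‖x‖ = 1 → ‖|x| ⊓ e‖ < r → r ≤ ‖T x‖ := by
  by_contra! hcon
  have hpick : ∀ (n : ℕ) (u : E), ∃ x, 0 ≤ u → ‖x‖ = 1 ∧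
      ‖T x‖ ≤ 1 / 16 * ((1 / 2) ^ n * (1 / 2) ^ n) ∧
      ‖|x| ⊓ u‖ ≤ 1 / 16 * ((1 / 2) ^ n * (1 / 2) ^ n) := by
    intro n u
    by_cases hu : 0 ≤ u
    swap
    · exact ⟨0, fun h => absurd h hu⟩
    obtain ⟨δ, hδ⟩ : ∃ δ : ℝ, δ = 1 / 16 * ((1 / 2) ^ n * (1 / 2) ^ n) := ⟨_, rfl⟩
    have hδ0 : 0 < δ := by rw [hδ]; positivity
    rw [← hδ]
    obtain ⟨m, hm⟩ := (Metric.tendsto_nhds.1 (tendsto_inf_nsmul_weakUnit hE he u) (δ / 2)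
      (half_pos hδ0)).exists
    rw [dist_comm, dist_eq_norm] at hm
    have hm1 : (0 : ℝ) < (m : ℝ) + 1 := by positivity
    -- The two terms of `norm_abs_inf_le` each contribute at most `δ / 2`.
    obtain ⟨x, hx1, hxe, hxT⟩ := hcon (min δ (δ / 2 / ((m : ℝ) + 1)))
      (lt_min hδ0 (div_pos (half_pos hδ0) hm1))
    refine ⟨x, fun _ => ⟨hx1, hxT.le.trans (min_le_left _ _), ?_⟩⟩
    have h1 := hxe.le.trans (min_le_right _ _)
    rw [le_div_iff₀ hm1] at h1
    have h2 := norm_abs_inf_le (x := x) hu he.1 m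
    linarith
  choose g hg using hpick
  -- Each new vector is chosen almost disjoint from the sum of the moduli of its predecessors, hence
  -- from each of them.
  let S : ℕ → E := fun n => Nat.rec 0 (fun n s => s + |g n s|) n
  have hS : ∀ n, S (n + 1) = S n + |g n (S n)| := fun n => rfl
  have hmono : Monotone S := monotone_nat_of_le_succ fun n => by
    rw [hS]; exact le_add_of_nonneg_right (abs_nonneg _)
  have hS0 : ∀ n, 0 ≤ S n := fun n => hmono (Nat.zero_le n)
  let x : ℕ → E := fun n => g n (S n)
  have hx : ∀ n, ‖x n‖ = 1 ∧ ‖T (x n)‖ ≤ 1 / 16 * ((1 / 2) ^ n * (1 / 2) ^ n) ∧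
      ‖|x n| ⊓ S n‖ ≤ 1 / 16 * ((1 / 2) ^ n * (1 / 2) ^ n) := fun n => hg n (S n) (hS0 n)
  have hlt : ∀ i j, i < j → ‖|x i| ⊓ |x j|‖ ≤ 1 / 16 * ((1 / 2) ^ i * (1 / 2) ^ j) := by
    intro i j hij
    have h1 : |x i| ≤ S j := by
      refine le_trans ?_ (hmono (Nat.succ_le_of_lt hij))
      rw [Nat.succ_eq_add_one, hS]
      exact le_add_of_nonneg_left (hS0 i)
    have h2 : ‖|x i| ⊓ |x j|‖ ≤ ‖|x j| ⊓ S j‖ := by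
      refine norm_le_norm_of_nonneg_of_le (le_inf (abs_nonneg _) (abs_nonneg _)) ?_
      rw [inf_comm]
      exact inf_le_inf_left _ h1
    refine h2.trans ((hx j).2.2.trans ?_)
    have h3 : (1 / 2 : ℝ) ^ j ≤ (1 / 2) ^ i :=
      pow_le_pow_of_le_one (by norm_num) (by norm_num) hij.le
    gcongr
  -- With `η = 1 / 16` the perturbation is at most `1 / 4`, which keeps `‖d n‖ ≥ 1 / 2`.
  obtain ⟨d, hd, hxd⟩ := exists_disjoint_near (x := x) (η := 1 / 16) (by norm_num) (by
    intro i j hij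
    rcases hij.lt_or_gt with h | h
    · exact hlt i j h
    · rw [inf_comm, mul_comm ((1 / 2 : ℝ) ^ i)]
      exact hlt j i h)
  have hhalf : ∀ n : ℕ, (1 / 2 : ℝ) ^ n ≤ 1 := fun n => pow_le_one₀ (by norm_num) (by norm_num)
  have hd2 : ∀ n, 1 / 2 ≤ ‖d n‖ := by
    intro n
    have h1 := norm_le_norm_add_norm_sub' (x n) (d n)
    have h2 := hxd n
    have h3 := hhalf n
    rw [(hx n).1] at h1
    linarith
  refine hT ⟨d, fun n h => ?_, hd, strictlySingular_of_summable T hd hd2 ?_⟩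
  · have := hd2 n
    rw [h, norm_zero] at this
    linarith
  · refine Summable.of_nonneg_of_le (fun n => norm_nonneg _) (fun n => ?_)
      (summable_geometric_two.mul_left (1 + ‖T‖))
    have h1 : T (d n) = T (x n) - T (x n - d n) := by rw [map_sub]; abel
    have h2 : ‖T (x n - d n)‖ ≤ ‖T‖ * (4 * (1 / 16) * (1 / 2) ^ n) :=
      T.le_of_opNorm_le_of_le le_rfl (hxd n)
    have h3 : (1 / 2 : ℝ) ^ n * (1 / 2) ^ n ≤ 1 * (1 / 2) ^ n := by
      have := hhalf n
      gcongr
    have h4 : 0 ≤ ‖T‖ * (1 / 2 : ℝ) ^ n := by positivity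
    have h5 : 0 ≤ (1 / 2 : ℝ) ^ n := by positivity
    rw [h1]
    refine (norm_sub_le _ _).trans ?_
    have h6 := (hx n).2.1
    nlinarith

end

end BanachLattice

/-! ### Transfer to the ultrapower. -/

namespace Ultrapower

open BanachLattice

section Norm

variable {I : Type w} {U : Ultrafilter I} {X : Type u} [NormedAddCommGroup X] [NormedSpace ℝ X]

theorem eventually_norm_lt {x : lp (fun _ : I => X) ∞} {C : ℝ} (h : ‖mk U x‖ < C) :
    ∀ᶠ i in (U : Filter I), ‖x i‖ < C := by
  obtain ⟨y, hyx, hy⟩ := exists_mk_eq_norm_lt (mk U x) (half_pos (sub_pos.2 h))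
  filter_upwards [mem_nullSubmodule_iff.1 (mk_eq_mk.1 hyx) _ (half_pos (sub_pos.2 h))] with i hi
  have h1 : ‖y i‖ ≤ ‖y‖ := lp.norm_apply_le_norm (by simp) y i
  have h2 : ‖x i‖ ≤ ‖y i‖ + ‖(y - x) i‖ := by
    simpa using norm_sub_le (y i) ((y - x) i)
  linarith

/-- The class of a constant family. -/
noncomputable def const (U : Ultrafilter I) (a : X) : Ultrapower U X :=
  mk U ⟨fun _ => a, memℓp_infty ⟨‖a‖, by rintro _ ⟨i, rfl⟩; exact le_rfl⟩⟩

theorem norm_const_le (U : Ultrafilter I) (a : X) : ‖const U a‖ ≤ ‖a‖ :=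
  (norm_mk_le _).trans (lp.norm_le_of_forall_le (norm_nonneg _) fun _ => le_rfl)

end Norm

section Lattice

variable {I : Type w} {U : Ultrafilter I} {E : Type u} [NormedAddCommGroup E] [NormedSpace ℝ E]
  [Lattice E] [HasSolidNorm E] [IsOrderedAddMonoid E]

/-- The ultrafilter dichotomy: otherwise `‖x i‖ ≤ C` along `U`, which bounds the norm of the class.
With `eventually_norm_lt` this identifies that norm as the limit of the coordinate norms. -/
theorem eventually_le_norm {x : lp (fun _ : I => E) ∞} {C : ℝ} (hC : 0 ≤ C) (h : C < ‖mk U x‖) :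
    ∀ᶠ i in (U : Filter I), C < ‖x i‖ := by
  by_contra hcon
  rw [← Ultrafilter.eventually_not] at hcon
  exact absurd (norm_mk_le_of_eventually hC (hcon.mono fun i hi => not_lt.1 hi)) (not_le.2 h)

/-- The family `(|xᵢ| ∧ e)`. -/
noncomputable def lpTrunc (e : E) (x : lp (fun _ : I => E) ∞) : lp (fun _ : I => E) ∞ :=
  lpInf (lpSup x (-x)) ⟨fun _ => e, memℓp_infty ⟨‖e‖, by rintro _ ⟨i, rfl⟩; exact le_rfl⟩⟩

set_option linter.unusedSectionVars false in
theorem lpTrunc_apply (e : E) (x : lp (fun _ : I => E) ∞) (i : I) :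
    lpTrunc e x i = |x i| ⊓ e := rfl

theorem mk_lpTrunc (e : E) (x : lp (fun _ : I => E) ∞) :
    mk U (lpTrunc e x) = |mk U x| ⊓ const U e := rfl

theorem const_nonneg {e : E} (he : 0 ≤ e) : 0 ≤ const U e :=
  mk_le_mk_of_le (x := 0) fun _ => he

/-- The lower bound of an operator on the normalized vectors with small truncation passes to its
ultrapower. -/
theorem half_le_norm_map {Y : Type v} [NormedAddCommGroup Y] [NormedSpace ℝ Y] {e : E}
    {T : E →L[ℝ] Y} {r : ℝ} (hr : 0 < r)
    (h : ∀ x, ‖x‖ = 1 → ‖|x| ⊓ e‖ < r → r ≤ ‖T x‖) {g : Ultrapower U E} (hg : ‖g‖ = 1)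
    (hge : ‖|g| ⊓ const U e‖ < r) : r / 2 ≤ ‖map U T g‖ := by
  obtain ⟨x, rfl⟩ := mk_surjective U g
  by_contra! hlt
  -- Normalizing a coordinate moves it, and its truncation, by at most `δ`. The bound `1 / 2` keeps
  -- `‖x i‖ > 1 / 2`, which accounts for the halved constant.
  obtain ⟨δ, hδ0, hδ⟩ : ∃ δ > 0, ‖|mk U x| ⊓ const U e‖ + δ < r ∧ δ ≤ 1 / 2 := by
    refine ⟨min ((r - ‖|mk U x| ⊓ const U e‖) / 2) (1 / 2), by
      refine lt_min (half_pos (sub_pos.2 hge)) (by norm_num), ?_, min_le_right _ _⟩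
    have := min_le_left ((r - ‖|mk U x| ⊓ const U e‖) / 2) (1 / 2)
    linarith
  rw [← mk_lpTrunc] at hδ
  rw [map_mk] at hlt
  have e1 := eventually_norm_lt (U := U) (x := x) (C := 1 + δ) (by rw [hg]; linarith)
  have e2 := eventually_le_norm (U := U) (x := x) (C := 1 - δ) (by linarith [hδ.2])
    (by rw [hg]; linarith)
  have e3 := eventually_norm_lt (U := U) (x := lpTrunc e x) (C := r - δ) (by linarith [hδ.1])
  obtain ⟨i, ⟨⟨h1, h2⟩, h3⟩, h4⟩ := (((e1.and e2).and e3).and (eventually_norm_lt hlt)).exists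
  rw [lpTrunc_apply] at h3
  rw [lpMap_apply] at h4
  have hpos : 0 < ‖x i‖ := by linarith [hδ.2]
  have hnorm : ‖‖x i‖⁻¹ • x i‖ = 1 := by
    rw [norm_smul, norm_inv, norm_norm, inv_mul_cancel₀ hpos.ne']
  have hclose : ‖‖x i‖⁻¹ • x i - x i‖ ≤ δ := by
    have h5 : ‖x i‖⁻¹ • x i - x i = (‖x i‖⁻¹ - 1) • x i := by rw [sub_smul, one_smul]
    have h6 : ‖(‖x i‖⁻¹ - 1) • x i‖ = |1 - ‖x i‖| := by
      rw [norm_smul, Real.norm_eq_abs, ← abs_of_pos hpos, ← abs_mul, abs_of_pos hpos, sub_mul,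
        inv_mul_cancel₀ hpos.ne', one_mul]
    rw [h5, h6, abs_le]
    constructor <;> linarith
  have htr : ‖|‖x i‖⁻¹ • x i| ⊓ e‖ < r := by
    have h5 := norm_inf_sub_inf_le_norm |‖x i‖⁻¹ • x i| |x i| e
    have h6 := norm_abs_sub_abs (‖x i‖⁻¹ • x i) (x i)
    have h7 := norm_le_norm_add_norm_sub' (|‖x i‖⁻¹ • x i| ⊓ e) (|x i| ⊓ e)
    linarith
  have h5 := h _ hnorm htr
  rw [map_smul, norm_smul, norm_inv, norm_norm, inv_mul_eq_div, le_div_iff₀ hpos] at h5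
  have h6 : r * (1 / 2) ≤ r * ‖x i‖ := mul_le_mul_of_nonneg_left (by linarith [hδ.2]) hr.le
  linarith

/-- The truncations of a disjoint sequence of the ultrapower are not bounded away from zero. -/
theorem exists_norm_abs_inf_const_lt [CompleteSpace E] [IsOrderedModule ℝ E]
    (hE : OrderContinuousNorm E) {e : E} (he : 0 ≤ e) {f : ℕ → Ultrapower U E} (hf : IsDisjointSeq f)
    {ε : ℝ} (hε : 0 < ε) : ∃ k, ‖|f k| ⊓ const U e‖ < ε := by
  by_contra! hcon
  -- Coordinates of disjoint classes need not be disjoint; only the norm bound on the sum descends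
  -- to them, with `1` as slack.
  obtain ⟨N, hN⟩ := exists_bound_of_norm_sum_le hE e (‖e‖ + 1) (half_pos hε)
  choose x hx using fun k => mk_surjective U (f k)
  have hz : ∀ k, mk U (lpTrunc e (x k)) = |f k| ⊓ const U e := fun k => by
    rw [mk_lpTrunc, hx]
  have h0 : ∀ k, 0 ≤ |f k| ⊓ const U e := fun k => le_inf (abs_nonneg _) (const_nonneg he)
  have hsum : ‖mk U (∑ k ∈ Finset.range N, lpTrunc e (x k))‖ < ‖e‖ + 1 := by
    rw [map_sum]
    simp only [hz]
    have h1 : ∑ k ∈ Finset.range N, |f k| ⊓ const U e ≤ const U e := by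
      refine sum_le_of_disjoint _ (const_nonneg he) (fun i j hij => ?_) h0 fun k => inf_le_right
      refine abs_inf_abs_eq_zero_of_le (hf hij) ?_ ?_ <;>
      · rw [abs_of_nonneg (h0 _)]
        exact inf_le_left
    have h2 := norm_le_norm_of_nonneg_of_le (Finset.sum_nonneg fun k _ => h0 k) h1
    have h3 := norm_const_le U e
    linarith
  have hlow : ∀ᶠ i in (U : Filter I), ∀ k ∈ Finset.range N, ε / 2 < ‖lpTrunc e (x k) i‖ := by
    rw [Filter.eventually_all_finset]
    intro k _
    refine eventually_le_norm (half_pos hε).le ?_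
    rw [hz]
    exact (half_lt_self hε).trans_le (hcon k)
  obtain ⟨i, hi1, hi2⟩ := ((eventually_norm_lt hsum).and hlow).exists
  rw [lp.coeFn_sum, Finset.sum_apply] at hi1
  obtain ⟨k, hk, hlt⟩ := hN (fun k => lpTrunc e (x k) i)
    (fun k => le_inf (abs_nonneg _) he) (fun k => inf_le_right) hi1.le
  exact absurd (hi2 k (Finset.mem_range.2 hk)) (not_lt.2 hlt.le)

end Lattice

end Ultrapower

/-! ### Lower bounds on the span of a disjoint sequence, and the conclusion. -/

namespace BanachLattice

section

variable {E : Type u} {Y : Type v} [NormedAddCommGroup E] [NormedSpace ℝ E]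
  [Lattice E] [HasSolidNorm E] [IsOrderedAddMonoid E] [IsOrderedModule ℝ E]
  [NormedAddCommGroup Y] [NormedSpace ℝ Y]

theorem linearIndependent_of_disjoint {x : ℕ → E} (h : IsDisjointSeq x) (h0 : ∀ n, x n ≠ 0) :
    LinearIndependent ℝ x := by
  rw [linearIndependent_iff']
  intro s a hs i hi
  have h1 := norm_smul_le_norm_sum h a hi
  rw [hs, norm_zero, norm_le_zero_iff, smul_eq_zero] at h1
  exact h1.resolve_right (h0 i)

/-- Disjointness and normalization bound every coefficient by `1`, so the truncation of the
combination lies below the sum of the truncations of the generators, uniformly in the coefficients.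
-/
theorem norm_abs_inf_sum_le {e : E} (he : 0 ≤ e) {x : ℕ → E} (hx : IsDisjointSeq x)
    (hx1 : ∀ n, ‖x n‖ = 1) {b : ℕ → ℝ} {B : ℝ} (hb : HasSum b B)
    (hxb : ∀ n, ‖|x n| ⊓ e‖ ≤ b n) (s : Finset ℕ) (a : ℕ → ℝ)
    (ha : ‖∑ k ∈ s, a k • x k‖ ≤ 1) : ‖|∑ k ∈ s, a k • x k| ⊓ e‖ ≤ B := by
  have h1 : |∑ k ∈ s, a k • x k| ⊓ e ≤ ∑ k ∈ s, |x k| ⊓ e := by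
    rw [inf_comm]
    simp only [inf_comm _ e]
    refine (inf_le_inf_left _ ?_).trans (inf_sum_le_sum_inf s he fun k => abs_nonneg (x k))
    refine (abs_sum_le_sum_abs _ _).trans (Finset.sum_le_sum fun k hk => ?_)
    have h2 := (norm_smul_le_norm_sum hx a hk).trans ha
    rw [norm_smul, hx1, mul_one, Real.norm_eq_abs] at h2
    rw [abs_smul_eq]
    exact smul_le_of_le_one_left (abs_nonneg _) h2
  refine (norm_le_norm_of_nonneg_of_le (le_inf (abs_nonneg _) he) h1).trans
    ((norm_sum_le _ _).trans ((Finset.sum_le_sum fun k _ => hxb k).trans ?_))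
  exact sum_le_hasSum s (fun k _ => (norm_nonneg _).trans (hxb k)) hb

/-- An operator bounded below on the closed span of a linearly independent sequence lying in a
closed subspace is not strictly singular on that subspace. -/
theorem not_strictlySingular_of_lower_bound {X : Type u} [NormedAddCommGroup X] [NormedSpace ℝ X]
    {T : X →L[ℝ] Y} {N : Submodule ℝ X} {x : ℕ → X} (hx : LinearIndependent ℝ x)
    (hN : closedSpanSeq x ≤ N) {c : ℝ} (hc : 0 < c)
    (h : ∀ g ∈ Submodule.span ℝ (Set.range x), c * ‖g‖ ≤ ‖T g‖) :
    ¬ StrictlySingular (T.domRestrict N) := by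
  have hcl : ∀ g ∈ closedSpanSeq x, c * ‖g‖ ≤ ‖T g‖ := by
    have : IsClosed {g : X | c * ‖g‖ ≤ ‖T g‖} :=
      isClosed_le (continuous_const.mul continuous_norm) T.continuous.norm
    exact closure_minimal h this
  have hmem : ∀ n, x n ∈ closedSpanSeq x := fun n =>
    Submodule.le_topologicalClosure _ (Submodule.subset_span ⟨n, rfl⟩)
  refine not_not.2 ⟨(closedSpanSeq x).comap N.subtype, ?_, fun hfin => ?_, ?_⟩
  · exact (Submodule.isClosed_topologicalClosure _).preimage continuous_subtype_val
  · let y : ℕ → (closedSpanSeq x).comap N.subtype := fun n => ⟨⟨x n, hN (hmem n)⟩, hmem n⟩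
    have hy : LinearIndependent ℝ y :=
      LinearIndependent.of_comp (N.subtype ∘ₗ ((closedSpanSeq x).comap N.subtype).subtype) hx
    exact Set.infinite_univ.not_finite (Set.finite_univ_iff.2 hy.finite)
  · have hanti : AntilipschitzWith (Real.toNNReal c⁻¹)
        ((T.domRestrict N).domRestrict ((closedSpanSeq x).comap N.subtype)) := by
      refine ContinuousLinearMap.antilipschitz_of_bound _ fun g => ?_
      rw [Real.coe_toNNReal _ (inv_pos.2 hc).le, inv_mul_eq_div, le_div_iff₀ hc, mul_comm]
      exact hcl _ g.2
    exact (hanti.isUniformEmbedding (ContinuousLinearMap.uniformContinuous _)).isEmbedding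

end

end BanachLattice

open BanachLattice

theorem corollary5p5 {E : Type u} {Y : Type v}
    [NormedAddCommGroup E] [NormedSpace ℝ E] [CompleteSpace E]
    [Lattice E] [HasSolidNorm E] [IsOrderedAddMonoid E] [IsOrderedModule ℝ E]
    [NormedAddCommGroup Y] [NormedSpace ℝ Y] [CompleteSpace Y]
    (hE : OrderContinuousNorm E) (he : ∃ e : E, IsWeakUnit e)
    {I : Type w} (U : Ultrafilter I) (hU : ∀ i : I, U ≠ pure i)
    (T : E →L[ℝ] Y) (hT : DisjointlyNonSingular T) :
    DisjointlyNonSingular (Ultrapower.map U T) := by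
  obtain ⟨e, he⟩ := he
  obtain ⟨r, hr, hrT⟩ := exists_lower_bound_of_disjointlyNonSingular hE he hT
  rintro ⟨f, hf0, hf, hss⟩
  let f' : ℕ → Ultrapower U E := fun n => ‖f n‖⁻¹ • f n
  have hf' : IsDisjointSeq f' := pairwise_disjoint_smul hf _
  have hf1 : ∀ n, ‖f' n‖ = 1 := fun n => by
    rw [norm_smul, norm_inv, norm_norm, inv_mul_cancel₀ (norm_ne_zero_iff.2 (hf0 n))]
  -- The bounds sum to `r / 2`, so normalized vectors of the span have truncation of norm below `r`.
  obtain ⟨σ, hσ, hσe⟩ : ∃ σ : ℕ → ℕ, StrictMono σ ∧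
      ∀ n, ‖|f' (σ n)| ⊓ Ultrapower.const U e‖ < r / 4 * (1 / 2) ^ n := by
    refine Filter.extraction_forall_of_frequently
      (P := fun n k => ‖|f' k| ⊓ Ultrapower.const U e‖ < r / 4 * (1 / 2) ^ n) fun n => ?_
    rw [Filter.frequently_atTop]
    intro m
    -- Applying this to the tail from `m` on yields small truncations at arbitrarily large indices.
    obtain ⟨k, hk⟩ := Ultrapower.exists_norm_abs_inf_const_lt hE he.1
      (f := fun k => f' (m + k)) (fun i j hij => hf' (by omega))
      (ε := r / 4 * (1 / 2) ^ n) (by positivity)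
    exact ⟨m + k, Nat.le_add_right m k, hk⟩
  let x : ℕ → Ultrapower U E := f' ∘ σ
  have hx : IsDisjointSeq x := fun i j hij => hf' (hσ.injective.ne hij)
  have hx1 : ∀ n, ‖x n‖ = 1 := fun n => hf1 _
  have hspan : closedSpanSeq x ≤ closedSpanSeq f := by
    refine Submodule.topologicalClosure_mono (Submodule.span_le.2 ?_)
    rintro _ ⟨n, rfl⟩
    exact Submodule.smul_mem _ _ (Submodule.subset_span ⟨_, rfl⟩)
  refine not_strictlySingular_of_lower_bound
    (linearIndependent_of_disjoint hx fun n h => by simpa [h] using hx1 n) hspan (half_pos hr)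
    (fun g hg => ?_) hss
  rcases eq_or_ne g 0 with rfl | hg0
  · simp
  have hgpos : 0 < ‖g‖ := norm_pos_iff.2 hg0
  have hnorm : ‖‖g‖⁻¹ • g‖ = 1 := by
    rw [norm_smul, norm_inv, norm_norm, inv_mul_cancel₀ hgpos.ne']
  have htr : ‖|‖g‖⁻¹ • g| ⊓ Ultrapower.const U e‖ < r := by
    obtain ⟨a, ha⟩ := Finsupp.mem_span_range_iff_exists_finsupp.1
      (Submodule.smul_mem _ ‖g‖⁻¹ hg)
    rw [Finsupp.sum] at ha
    have h1 := norm_abs_inf_sum_le (Ultrapower.const_nonneg he.1) hx hx1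
      (hasSum_geometric_two.mul_left (r / 4)) (fun n => (hσe n).le) a.support a
      (by rw [ha, hnorm])
    rw [ha] at h1
    exact h1.trans_lt (by linarith)
  have h := Ultrapower.half_le_norm_map hr hrT hnorm htr
  rwa [map_smul, norm_smul, norm_inv, norm_norm, inv_mul_eq_div, le_div_iff₀ hgpos] at h
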